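/- Let $Q\subset\mathbb R^d$ be the input space, let $f_1:Q\to\mathbb R^{p_1}$ and $f_2:Q\to\mathbb R^{p_2}$ be regression functions, and let $r_1,r_2:\mathbb R^d\to\mathbb R$ be correlation functions (in particular $r_1(0)=r_2(0)=1$). Let $D_t=\{x^{(t)}_1,\dots,x^{(t)}_{n_t}\}\subset Q$ ($t=1,2$) be designs with $D_2\subseteq D_1$. Let $\rho\in\mathbb R$, $\sigma_1^2,\sigma_2^2>0$ and $\beta_2\in\mathbb R^{p_2}$ be known. Given $\beta_1\in\mathbb R^{p_1}$, let $(Z_1(x))_{x\in Q}$ and $(\delta(x))_{x\in Q}$ be independent Gaussian processes with means $f_1(x)^T\beta_1$, $f_2(x)^T\beta_2$ and covariance functions $\sigma_1^2r_1(x-x')$, $\sigma_2^2r_2(x-x')$ respectively (the law of $\delta$ does not depend on $\beta_1$), and put $Z_2(x)=\rho Z_1(x)+\delta(x)$. The observed vector is $\mathcal Z=(Z_1(x^{(1)}_1),\dots,Z_1(x^{(1)}_{n_1}),Z_2(x^{(2)}_1),\dots,Z_2(x^{(2)}_{n_2}))^T$, with value $z=(z_1^T,z_2^T)^T$. Write $R_t(D,D')$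 for the matrix with entries $r_t(x-x')$, $x\in D$, $x'\in D'$, and $R_t(D)=R_t(D,D)$; write $F_t(D)$ for the matrix with rows $f_t(x)^T$, $x\in D$, and $F_1=F_1(D_1)$. Let $$H=\begin{pmatrix}F_1(D_1)&0\\ \rho F_1(D_2)&F_2(D_2)\end{pmatrix},\qquad V=\begin{pmatrix}\sigma_1^2R_1(D_1)&\rho\sigma_1^2R_1(D_1,D_2)\\ \rho\sigma_1^2R_1(D_2,D_1)&\rho^2\sigma_1^2R_1(D_2)+\sigma_2^2R_2(D_2)\end{pmatrix},$$ $$h'(x)^T=(\rho f_1(x)^T,f_2(x)^T),\qquad t(x)^T=\big(\rho\sigma_1^2R_1(\{x\},D_1),\ \rho^2\sigma_1^2R_1(\{x\},D_2)+\sigma_2^2R_2(\{x\},D_2)\big).$$ For $\beta=(\beta_1^T,\beta_2^T)^T$ the kriging mean and variance are $$m_{Z_2}(x;\beta_1,z)=h'(x)^T\beta+t(x)^TV^{-1}(z-H\beta),\qquad s^2_{Z_2}(x)=\rho^2\sigma_1^2+\sigma_2^2-t(x)^TV^{-1}t(x).$$ Consider one of two priors for $\beta_1$: (I) $\beta_1\sim\mathcal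 N(b_1,\sigma_1^2V_1)$ with $b_1\in\mathbb R^{p_1}$ and $V_1$ diagonal with positive diagonal entries; (II) the improper flat prior $p(\beta_1)\propto1$. Put $$A_{\rm I}^1=\Big[F_1^T\tfrac{R_1(D_1)^{-1}}{\sigma_1^2}F_1+\tfrac{V_1^{-1}}{\sigma_1^2}\Big]^{-1},\quad \nu_{\rm I}^1=F_1^T\tfrac{R_1(D_1)^{-1}}{\sigma_1^2}z_1+\tfrac{V_1^{-1}}{\sigma_1^2}b_1,\qquad A_{\rm II}^1=\Big[F_1^T\tfrac{R_1(D_1)^{-1}}{\sigma_1^2}F_1\Big]^{-1},\quad \nu_{\rm II}^1=F_1^T\tfrac{R_1(D_1)^{-1}}{\sigma_1^2}z_1 .$$ Assume that $R_1(D_1)$ and $R_2(D_2)$ are invertible and, in case (II), that $F_1^TR_1(D_1)^{-1}F_1$ is invertible. Let $x\in Q$ and, for $i\in\{{\rm I},{\rm II}\}$, $$\mu_i(x)=m_{Z_2}(x;A_i^1\nu_i^1,z),\qquad \sigma_i^2(x)=s^2_{Z_2}(x)+k_1A_i^1k_1^T,$$ where $k_1$ consists of the first $p_1$ entries of the row vector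 $k=h'(x)^T-t(x)^TV^{-1}H$. Then $V$ is invertible, $A_i^1$ is positive definite, $s^2_{Z_2}(x)\ge0$, $\sigma_i^2(x)\ge0$, and: 1. the posterior law of $\beta_1$ given $\mathcal Z=z$ is $\mathcal N(A_i^1\nu_i^1,A_i^1)$; 2. for every $\beta_1$, the law of $Z_2(x)$ given $\mathcal Z=z$ and $\beta_1$ is $\mathcal N(m_{Z_2}(x;\beta_1,z),s^2_{Z_2}(x))$; 3. for every $z$, integrating the law in 2 over $\beta_1$ with respect to the posterior law in 1 gives $\mathcal N(\mu_i(x),\sigma_i^2(x))$; 4. the predictive distribution, with $\beta_2,\rho,\sigma_1^2,\sigma_2^2$ known, is $$[Z_2(x)\mid\mathcal Z=z]\sim\mathcal N(\mu_i(x),\sigma_i^2(x)).$$ Here a Gaussian law with variance $0$ is a Dirac mass. Conditional laws are regular conditional distributions, i.e. disintegrations of the joint law of the quantity of interest and $\mathcal Z$ with respect to the law of $\mathcal Z$; in 1 and 4 this is taken under the joint measure "prior of $\beta_1$ times model given $\beta_1$", and in case (II), where that measure is infinite, the marginal law of $\mathcal Z$ is $\sigma$-finite. -/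

import Mathlib

open MeasureTheory ProbabilityTheory Matrix

namespace CoKriging

/-- `κ` is a (regular) conditional law of `X` given `Y` under the measure `M`: the law of `Y` is
σ-finite, `y ↦ κ y` is a Markov kernel, and the law of `(Y, X)` disintegrates as `law(Y) ⊗ κ`.
If `M` is a probability measure this is the usual conditional distribution `[X | Y = y]`; for an
infinite `M` (arising from an improper prior) it is the usual extension of that notion. -/
def IsCondLaw {Ω E F : Type*} [MeasurableSpace Ω] [MeasurableSpace E] [MeasurableSpace F]
    (M : Measure Ω) (X : Ω → F) (Y : Ω → E) (κ : E → Measure F) : Prop :=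
  SigmaFinite (M.map Y) ∧
    ∃ K : Kernel E F, IsMarkovKernel K ∧ (∀ y, K y = κ y) ∧
      M.map (fun ω => (Y ω, X ω)) = (M.map Y) ⊗ₘ K

/-- The known quantities of a two-level co-kriging model (the vector `β₁` is not among them). -/
structure Setup (d n₁ n₂ p₁ p₂ : ℕ) where
  /-- input space -/
  Q : Set (EuclideanSpace ℝ (Fin d))
  /-- regression functions of the cheap code -/
  f₁ : Q → Fin p₁ → ℝ
  /-- regression functions of the discrepancy process -/
  f₂ : Q → Fin p₂ → ℝ
  /-- correlation functions -/
  r₁ : EuclideanSpace ℝ (Fin d) → ℝ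
  r₂ : EuclideanSpace ℝ (Fin d) → ℝ
  r₁_zero : r₁ 0 = 1
  r₂_zero : r₂ 0 = 1
  /-- experimental designs, with the expensive one contained in the cheap one -/
  D₁ : Fin n₁ → Q
  D₂ : Fin n₂ → Q
  nested : Set.range D₂ ⊆ Set.range D₁
  /-- scale factor, standard deviations, regression coefficients of the discrepancy -/
  ρ : ℝ
  σ₁ : ℝ
  σ₂ : ℝ
  σ₁_pos : 0 < σ₁
  σ₂_pos : 0 < σ₂
  β₂ : Fin p₂ → ℝ

/-- The prior of `β₁` given `σ₁²`: (I) Gaussian with mean `b` and covariance `σ₁² diag(v)`,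
or (II) the non-informative (flat, improper) one. -/
inductive Prior (p : ℕ) where
  | informative (b v : Fin p → ℝ) (hv : ∀ i, 0 < v i)
  | nonInformative

variable {d n₁ n₂ p₁ p₂ : ℕ}

/-- Correlation matrix between two finite families of points. -/
def corrMatrix {Q : Set (EuclideanSpace ℝ (Fin d))} {m n : ℕ} (r : EuclideanSpace ℝ (Fin d) → ℝ)
    (D : Fin m → Q) (D' : Fin n → Q) : Matrix (Fin m) (Fin n) ℝ :=
  Matrix.of fun i j => r ((D i : EuclideanSpace ℝ (Fin d)) - D' j)

/-- Design matrix `F(D)`, whose rows are `f(x)ᵀ` for `x` in `D`. -/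
def designMatrix {Q : Set (EuclideanSpace ℝ (Fin d))} {m p : ℕ} (f : Q → Fin p → ℝ)
    (D : Fin m → Q) : Matrix (Fin m) (Fin p) ℝ :=
  Matrix.of fun i j => f (D i) j

namespace Setup

variable (S : Setup d n₁ n₂ p₁ p₂)

/-- `R₁(D₁)`. -/
def R₁ : Matrix (Fin n₁) (Fin n₁) ℝ := corrMatrix S.r₁ S.D₁ S.D₁

/-- `R₂(D₂)`. -/
def R₂ : Matrix (Fin n₂) (Fin n₂) ℝ := corrMatrix S.r₂ S.D₂ S.D₂

/-- `F₁ = F₁(D₁)`. -/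
def F₁ : Matrix (Fin n₁) (Fin p₁) ℝ := designMatrix S.f₁ S.D₁

/-- The matrix `H` with `E[𝒵] = H β`. -/
def H : Matrix (Fin n₁ ⊕ Fin n₂) (Fin p₁ ⊕ Fin p₂) ℝ :=
  Matrix.fromBlocks S.F₁ 0 (S.ρ • designMatrix S.f₁ S.D₂) (designMatrix S.f₂ S.D₂)

/-- The covariance matrix `V` of the observations. -/
def V : Matrix (Fin n₁ ⊕ Fin n₂) (Fin n₁ ⊕ Fin n₂) ℝ :=
  Matrix.fromBlocks
    (S.σ₁ ^ 2 • S.R₁)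
    ((S.ρ * S.σ₁ ^ 2) • corrMatrix S.r₁ S.D₁ S.D₂)
    ((S.ρ * S.σ₁ ^ 2) • corrMatrix S.r₁ S.D₂ S.D₁)
    ((S.ρ ^ 2 * S.σ₁ ^ 2) • corrMatrix S.r₁ S.D₂ S.D₂ + S.σ₂ ^ 2 • S.R₂)

/-- `h'(x)ᵀ = (ρ f₁(x)ᵀ, f₂(x)ᵀ)`. -/
def h (x : S.Q) : Fin p₁ ⊕ Fin p₂ → ℝ := Sum.elim (S.ρ • S.f₁ x) (S.f₂ x)

/-- `t(x)ᵀ = Cov(Z₂(x), 𝒵)`. -/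
def t (x : S.Q) : Fin n₁ ⊕ Fin n₂ → ℝ :=
  Sum.elim
    (fun j => S.ρ * S.σ₁ ^ 2 * S.r₁ ((x : EuclideanSpace ℝ (Fin d)) - S.D₁ j))
    (fun j => S.ρ ^ 2 * S.σ₁ ^ 2 * S.r₁ ((x : EuclideanSpace ℝ (Fin d)) - S.D₂ j)
      + S.σ₂ ^ 2 * S.r₂ ((x : EuclideanSpace ℝ (Fin d)) - S.D₂ j))

/-- The kriging mean `m_{Z₂}(x)` for given `β₁` and data `z`. -/
noncomputable def krigingMean (x : S.Q) (β₁ : Fin p₁ → ℝ) (z : Fin n₁ ⊕ Fin n₂ → ℝ) : ℝ :=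
  S.h x ⬝ᵥ Sum.elim β₁ S.β₂ + S.t x ⬝ᵥ (S.V⁻¹ *ᵥ (z - S.H *ᵥ Sum.elim β₁ S.β₂))

/-- The kriging variance `s²_{Z₂}(x)`. -/
noncomputable def krigingVar (x : S.Q) : ℝ :=
  S.ρ ^ 2 * S.σ₁ ^ 2 + S.σ₂ ^ 2 - S.t x ⬝ᵥ (S.V⁻¹ *ᵥ S.t x)

/-- `k = h'(x)ᵀ - t(x)ᵀ V⁻¹ H`. -/
noncomputable def k (x : S.Q) : Fin p₁ ⊕ Fin p₂ → ℝ := S.h x - S.t x ᵥ* (S.V⁻¹ * S.H)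

/-- The first `p₁` entries of `k`. -/
noncomputable def k₁ (x : S.Q) : Fin p₁ → ℝ := fun i => S.k x (Sum.inl i)

/-- The prior measure of `β₁`. -/
noncomputable def priorMeasure : Prior p₁ → Measure (EuclideanSpace ℝ (Fin p₁))
  | .informative b v _ => multivariateGaussian (WithLp.toLp 2 b) (S.σ₁ ^ 2 • Matrix.diagonal v)
  | .nonInformative => volume

/-- `A_i^1`. -/
noncomputable def A : Prior p₁ → Matrix (Fin p₁) (Fin p₁) ℝ
  | .informative _ v _ =>
      (S.F₁ᵀ * ((S.σ₁ ^ 2)⁻¹ • S.R₁⁻¹) * S.F₁ + (S.σ₁ ^ 2)⁻¹ • (Matrix.diagonal v)⁻¹)⁻¹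
  | .nonInformative => (S.F₁ᵀ * ((S.σ₁ ^ 2)⁻¹ • S.R₁⁻¹) * S.F₁)⁻¹

/-- `ν_i^1`, as a function of the cheap observations `z₁`. -/
noncomputable def ν (z₁ : Fin n₁ → ℝ) : Prior p₁ → Fin p₁ → ℝ
  | .informative b v _ =>
      (S.F₁ᵀ * ((S.σ₁ ^ 2)⁻¹ • S.R₁⁻¹)) *ᵥ z₁ + ((S.σ₁ ^ 2)⁻¹ • (Matrix.diagonal v)⁻¹) *ᵥ b
  | .nonInformative => (S.F₁ᵀ * ((S.σ₁ ^ 2)⁻¹ • S.R₁⁻¹)) *ᵥ z₁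

/-- `A_i^1 ν_i^1`, as a function of the data `z = (z₁, z₂)`. -/
noncomputable def postMean (π : Prior p₁) (z : Fin n₁ ⊕ Fin n₂ → ℝ) : Fin p₁ → ℝ :=
  S.A π *ᵥ S.ν (fun i => z (Sum.inl i)) π

/-- `μ_i(x)`: the kriging mean at `β₁ = A_i^1 ν_i^1`. -/
noncomputable def predMean (π : Prior p₁) (x : S.Q) (z : Fin n₁ ⊕ Fin n₂ → ℝ) : ℝ :=
  S.krigingMean x (S.postMean π z) z

/-- `σ²_i(x) = s²_{Z₂}(x) + k₁ A_i^1 k₁ᵀ`. -/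
noncomputable def predVar (π : Prior p₁) (x : S.Q) : ℝ :=
  S.krigingVar x + S.k₁ x ⬝ᵥ (S.A π *ᵥ S.k₁ x)

/-- The two-level model. `P β₁` is the probability given `β₁` (and the known parameters): under it
`Z₁` and `δ` are independent Gaussian processes with the prescribed means and covariances. -/
structure IsModel {Ω : Type*} [MeasurableSpace Ω] (Z₁ δ : S.Q → Ω → ℝ)
    (P : Kernel (EuclideanSpace ℝ (Fin p₁)) Ω) : Prop where
  measurable_Z₁ : ∀ x, Measurable (Z₁ x)
  measurable_δ : ∀ x, Measurable (δ x)
  gaussian_Z₁ : ∀ β₁, IsGaussianProcess Z₁ (P β₁)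
  gaussian_δ : ∀ β₁, IsGaussianProcess δ (P β₁)
  indep : ∀ β₁, IndepFun (fun ω x => Z₁ x ω) (fun ω x => δ x ω) (P β₁)
  mean_Z₁ : ∀ β₁ x, ∫ ω, Z₁ x ω ∂(P β₁) = S.f₁ x ⬝ᵥ β₁.ofLp
  mean_δ : ∀ β₁ x, ∫ ω, δ x ω ∂(P β₁) = S.f₂ x ⬝ᵥ S.β₂
  cov_Z₁ : ∀ β₁ x y, cov[Z₁ x, Z₁ y; P β₁] =
    S.σ₁ ^ 2 * S.r₁ ((x : EuclideanSpace ℝ (Fin d)) - y)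
  cov_δ : ∀ β₁ x y, cov[δ x, δ y; P β₁] =
    S.σ₂ ^ 2 * S.r₂ ((x : EuclideanSpace ℝ (Fin d)) - y)

/-- The expensive code `Z₂(x) = ρ Z₁(x) + δ(x)`. -/
def Z₂ {Ω : Type*} (Z₁ δ : S.Q → Ω → ℝ) (x : S.Q) (ω : Ω) : ℝ := S.ρ * Z₁ x ω + δ x ω

/-- The observed vector `𝒵 = (Z₁(D₁), Z₂(D₂))`. -/
def obs {Ω : Type*} (Z₁ δ : S.Q → Ω → ℝ) (ω : Ω) : Fin n₁ ⊕ Fin n₂ → ℝ :=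
  Sum.elim (fun i => Z₁ (S.D₁ i) ω) (fun j => S.Z₂ Z₁ δ (S.D₂ j) ω)

end Setup

end CoKriging

/-!
Given `Y`, the law of `X` is known as soon as some residual `X - g(Y)` is independent of `Y`: it is
the law of the residual translated by `g(Y)`. For jointly Gaussian vectors `g(y) = K y` works when
`K Cov(Y) = Cov(X, Y)`, which yields the kriging law of `Z₂(x)` given `β₁`, and also the posterior
of `β₁` under the Gaussian prior. Under the flat prior, translation invariance of Lebesgue measure
makes the error of the generalized least squares estimator of `β₁` independent of the data, so that
the same principle applies.

That the posterior only involves `z₁` comes from `D₂ ⊆ D₁`: writing `H₁` for the columns of `H` that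
multiply `β₁`, the matrix `G = (F₁ᵀ R₁(D₁)⁻¹ / σ₁², 0)` satisfies `G V = H₁ᵀ`, that is,
`H₁ᵀ V⁻¹ = G` ignores the expensive observations.

The kriging mean is affine in `β₁` with slope `k₁`, so averaging the kriging law over the posterior
convolves two Gaussian laws; by the tower property of disintegrations the average is the predictive
law.
-/

namespace CoKriging

section Disintegration

variable {Ω Ω' B E F G : Type*} [MeasurableSpace Ω] [MeasurableSpace Ω'] [MeasurableSpace B]
  [MeasurableSpace E] [MeasurableSpace F] [MeasurableSpace G]

namespace IsCondLaw

variable {M : Measure Ω} {X : Ω → F} {Y : Ω → E} {κ : E → Measure F}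

theorem of_map_eq {M' : Measure Ω'} {X' : Ω' → F} {Y' : Ω' → E} (h : IsCondLaw M X Y κ)
    (hX : Measurable X) (hX' : Measurable X')
    (hlaw : M'.map (fun ω => (Y' ω, X' ω)) = M.map (fun ω => (Y ω, X ω))) :
    IsCondLaw M' X' Y' κ := by
  have hlaw_fst : M'.map Y' = M.map Y := by
    simpa only [Measure.fst_map_prodMk hX', Measure.fst_map_prodMk hX] using
      congrArg Measure.fst hlaw
  simpa only [IsCondLaw, hlaw, hlaw_fst] using h

theorem map (h : IsCondLaw M X Y κ) (hX : Measurable X) (hY : Measurable Y) {f : F → G}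
    (hf : Measurable f) : IsCondLaw M (fun ω => f (X ω)) Y (fun y => (κ y).map f) := by
  obtain ⟨hσ, K, _, hK, hlaw⟩ := h
  refine ⟨hσ, K.map f, Kernel.IsMarkovKernel.map K hf,
    fun y => by rw [Kernel.map_apply K hf, hK], ?_⟩
  rw [Measure.compProd_map hf, ← hlaw, Measure.map_map (measurable_id.prodMap hf) (hY.prodMk hX)]
  rfl

theorem compProd {π : Measure B} [SigmaFinite π] {P : Kernel B Ω} [IsMarkovKernel P]
    (hX : Measurable X) (hY : Measurable Y) (K : Kernel (E × B) F) [IsMarkovKernel K]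
    (h : ∀ b, IsCondLaw (P b) X Y fun y => K (y, b)) :
    IsCondLaw (π ⊗ₘ P) (fun q => X q.2) (fun q => (Y q.2, q.1)) K := by
  have hYb : Measurable fun q : B × Ω => (Y q.2, q.1) := by fun_prop
  have hXq : Measurable fun q : B × Ω => X q.2 := by fun_prop
  have hsnd : ((π ⊗ₘ P).map fun q => (Y q.2, q.1)).map Prod.snd = π := by
    rw [Measure.map_map measurable_snd hYb]
    exact Measure.fst_compProd π P
  have hσ : SigmaFinite ((π ⊗ₘ P).map fun q => (Y q.2, q.1)) :=
    SigmaFinite.of_map _ measurable_snd.aemeasurable (by rw [hsnd]; infer_instance)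
  refine ⟨hσ, K, inferInstance, fun _ => rfl, Measure.ext_of_lintegral _ fun f hf => ?_⟩
  have hfq : Measurable fun q : B × Ω => f ((Y q.2, q.1), X q.2) := by fun_prop
  have hφ : Measurable fun p => ∫⁻ x, f (p, x) ∂K p := hf.lintegral_kernel_prod_right'
  have hφq : Measurable fun q : B × Ω => ∫⁻ x, f ((Y q.2, q.1), x) ∂K (Y q.2, q.1) :=
    hφ.comp hYb
  rw [lintegral_map hf (hYb.prodMk hXq), Measure.lintegral_compProd hfq,
    Measure.lintegral_compProd hf, lintegral_map hφ hYb, Measure.lintegral_compProd hφq]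
  refine lintegral_congr fun b => ?_
  obtain ⟨_, Kb, _, hKb, hlaw⟩ := h b
  have hfb : Measurable fun p : E × F => f ((p.1, b), p.2) := by fun_prop
  have hlaw_f := congrArg (fun m => ∫⁻ p, f ((p.1, b), p.2) ∂m) hlaw
  simp only [lintegral_map hfb (hY.prodMk hX), Measure.lintegral_compProd hfb] at hlaw_f
  rw [hlaw_f, lintegral_map hfb.lintegral_kernel_prod_right' hY]
  simp only [hKb]

theorem bind {T : Ω → B} {post : E → Measure B} {κ : E × B → Measure F}
    (hT : IsCondLaw M T Y post) (hX : IsCondLaw M X (fun ω => (Y ω, T ω)) κ)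
    (hmX : Measurable X) (hmT : Measurable T) (hmY : Measurable Y) :
    IsCondLaw M X Y fun y => (post y).bind fun b => κ (y, b) := by
  obtain ⟨hσ, Q, _, hQ, hlawT⟩ := hT
  obtain ⟨_, K, _, hK, hlawX⟩ := hX
  refine ⟨hσ, (Q ⊗ₖ K).snd, inferInstance, fun y => ?_, ?_⟩
  · rw [Kernel.snd_apply, Kernel.compProd_apply_eq_compProd_sectR, ← Measure.snd,
      Measure.snd_compProd, hQ]
    exact congrArg (post y).bind (funext fun b => hK (y, b))
  · rw [hlawT] at hlawX
    have hassoc : Measurable fun p : (E × B) × F => (p.1.1, p.2) := by fun_prop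
    have hcomp : (M.map fun ω => ((Y ω, T ω), X ω)).map (fun p => (p.1.1, p.2)) =
        M.map fun ω => (Y ω, X ω) :=
      Measure.map_map hassoc ((hmY.prodMk hmT).prodMk hmX)
    rw [← hcomp, hlawX, ← Measure.compProd_assoc, Kernel.snd_eq,
      Measure.compProd_map measurable_snd, Measure.map_map hassoc (MeasurableEquiv.measurable _)]
    rfl

end IsCondLaw

section Translation

variable [Add F]

/-- The kernel sending `y` to the translate of `τ` by `g y`. It is the conditional law of
`g Y + W` given `Y` when the noise `W` has law `τ` and is independent of `Y`. -/
noncomputable def translationKernel (τ : Measure F) (g : E → F) : Kernel E F :=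
  (Kernel.id ×ₖ Kernel.const E τ).map (fun p => g p.1 + p.2)

variable [MeasurableAdd₂ F] {τ : Measure F} {g : E → F}

lemma translationKernel_apply [SFinite τ] (hg : Measurable g) (y : E) :
    translationKernel τ g y = τ.map (fun x => g y + x) := by
  have hadd : Measurable fun p : E × F => g p.1 + p.2 := by fun_prop
  rw [translationKernel, Kernel.map_apply _ hadd, Kernel.prod_apply, Kernel.id_apply,
    Kernel.const_apply, Measure.dirac_prod, Measure.map_map hadd measurable_prodMk_left]
  rfl

lemma isMarkovKernel_translationKernel [IsProbabilityMeasure τ] (hg : Measurable g) :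
    IsMarkovKernel (translationKernel τ g) :=
  Kernel.IsMarkovKernel.map _ (by fun_prop)

lemma compProd_translationKernel [IsProbabilityMeasure τ] (hg : Measurable g) (μ : Measure E)
    [SFinite μ] :
    μ ⊗ₘ translationKernel τ g = (μ.prod τ).map (fun p => (p.1, g p.1 + p.2)) := by
  have := isMarkovKernel_translationKernel (τ := τ) hg
  have hadd : Measurable fun p : E × F => (p.1, g p.1 + p.2) := by fun_prop
  refine Measure.ext_of_lintegral _ fun f hf => ?_
  have hfadd : Measurable fun p : E × F => f (p.1, g p.1 + p.2) := hf.comp hadd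
  rw [Measure.lintegral_compProd hf, lintegral_map hf hadd, lintegral_prod _ hfadd.aemeasurable]
  refine lintegral_congr fun y => ?_
  have hfy : Measurable fun x => f (y, x) := hf.comp measurable_prodMk_left
  rw [translationKernel_apply hg, lintegral_map hfy (measurable_const_add _)]

lemma bind_translationKernel {F : Type*} [MeasurableSpace F] [AddMonoid F] [MeasurableAdd₂ F]
    {τ : Measure F} [IsProbabilityMeasure τ] {g : E → F} (hg : Measurable g) (μ : Measure E)
    [SFinite μ] : μ.bind (translationKernel τ g) = (μ.map g) ∗ τ := by
  have := isMarkovKernel_translationKernel (τ := τ) hg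
  have hprod : (μ.map g).prod τ = (μ.prod τ).map (Prod.map g id) := by
    rw [← Measure.map_prod_map μ τ hg measurable_id, Measure.map_id]
  rw [← Measure.snd_compProd, compProd_translationKernel hg, Measure.snd,
    Measure.map_map measurable_snd (by fun_prop), Measure.conv, hprod,
    Measure.map_map (by fun_prop) (by fun_prop)]
  rfl

lemma compProd_map_eq_prod_map {π : Measure B} [SFinite π] {P : Kernel B Ω} [IsSFiniteKernel P]
    [IsProbabilityMeasure τ] {Y : Ω → F} (hY : Measurable Y) {a : B → F} (ha : Measurable a)
    (h : ∀ b, (P b).map Y = τ.map (fun w => a b + w)) :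
    (π ⊗ₘ P).map (fun q => (q.1, Y q.2)) = (π.prod τ).map (fun p => (p.1, a p.1 + p.2)) := by
  have hP : P.map Y = translationKernel τ a := by
    ext1 b
    rw [Kernel.map_apply _ hY, h, translationKernel_apply ha]
  rw [← compProd_translationKernel ha, ← hP, Measure.compProd_map hY]
  rfl

end Translation

section Residual

variable [AddCommGroup F] [MeasurableAdd₂ F] [MeasurableSub₂ F] {M : Measure Ω} {X : Ω → F}
  {Y : Ω → E} {g : E → F}

theorem isCondLaw_of_map_residual_eq_prod (hX : Measurable X) (hY : Measurable Y)
    (hg : Measurable g) (hσ : SigmaFinite (M.map Y)) {τ : Measure F} [IsProbabilityMeasure τ]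
    (h : M.map (fun ω => (Y ω, X ω - g (Y ω))) = (M.map Y).prod τ) :
    IsCondLaw M X Y (fun y => τ.map (fun x => g y + x)) := by
  refine ⟨hσ, translationKernel τ g, isMarkovKernel_translationKernel hg,
    translationKernel_apply hg, ?_⟩
  rw [compProd_translationKernel hg, ← h, Measure.map_map (by fun_prop) (by fun_prop)]
  simp only [Function.comp_def, add_sub_cancel]

theorem isCondLaw_of_indepFun_residual [IsProbabilityMeasure M] (hX : Measurable X)
    (hY : Measurable Y) (hg : Measurable g) (h : IndepFun Y (fun ω => X ω - g (Y ω)) M) :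
    IsCondLaw M X Y (fun y => (M.map (fun ω => X ω - g (Y ω))).map (fun x => g y + x)) := by
  have hr : Measurable fun ω => X ω - g (Y ω) := by fun_prop
  have := Measure.isProbabilityMeasure_map (μ := M) hY.aemeasurable
  have := Measure.isProbabilityMeasure_map (μ := M) hr.aemeasurable
  exact isCondLaw_of_map_residual_eq_prod hX hY hg inferInstance
    ((indepFun_iff_map_prod_eq_prod_map_map hY.aemeasurable hr.aemeasurable).1 h)

end Residual

section TranslationInvariance

variable {μ : Measure B} {τ : Measure Ω} {u : Ω → B} {w : Ω → F} {φ : B × F → G}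

lemma map_prodMk_eq_prod_of_indepFun [SFinite μ] [IsProbabilityMeasure τ] (hu : Measurable u)
    (hw : Measurable w) (hφ : Measurable φ) (h : IndepFun w u τ) :
    (μ.prod τ).map (fun p => (φ (p.1, w p.2), u p.2)) =
      ((μ.prod τ).map fun p => φ (p.1, w p.2)).prod (τ.map u) := by
  have := Measure.isProbabilityMeasure_map (μ := τ) hu.aemeasurable
  have := Measure.isProbabilityMeasure_map (μ := τ) hw.aemeasurable
  have hwu : (μ.prod τ).map (fun p => (p.1, w p.2, u p.2)) =
      ((μ.prod (τ.map w)).prod (τ.map u)).map MeasurableEquiv.prodAssoc := by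
    rw [Measure.prodAssoc_prod,
      ← (indepFun_iff_map_prod_eq_prod_map_map hw.aemeasurable hu.aemeasurable).1 h]
    conv_rhs => rw [← μ.map_id, Measure.map_prod_map _ _ measurable_id (hw.prodMk hu)]
    rfl
  have hφw : (μ.prod τ).map (fun p => φ (p.1, w p.2)) = (μ.prod (τ.map w)).map φ := by
    conv_rhs => rw [← μ.map_id, Measure.map_prod_map _ _ measurable_id hw,
      Measure.map_map hφ (by fun_prop)]
    rfl
  have hassoc := congrArg (Measure.map fun q : B × F × B => (φ (q.1, q.2.1), q.2.2)) hwu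
  rw [Measure.map_map (by fun_prop) (by fun_prop),
    Measure.map_map (by fun_prop) MeasurableEquiv.prodAssoc.measurable] at hassoc
  rw [hφw]
  conv_rhs => rw [← (τ.map u).map_id, Measure.map_prod_map _ _ hφ measurable_id]
  exact hassoc

variable [AddCommGroup B] [MeasurableAdd₂ B] [MeasurableSub₂ B] [μ.IsAddRightInvariant]

lemma map_comp_prod_sub [SFinite μ] [SFinite τ] (hu : Measurable u) {f : B × Ω → E}
    (hf : Measurable f) :
    (μ.prod τ).map (fun p => f (p.1 - u p.2, p.2)) = (μ.prod τ).map f := by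
  have hskew : MeasurePreserving (fun p : Ω × B => (p.1, p.2 - u p.1)) (τ.prod μ) (τ.prod μ) :=
    (MeasurePreserving.id τ).skew_product (g := fun ω b => b - u ω) (by fun_prop)
      (ae_of_all _ fun ω => (measurePreserving_sub_right μ (u ω)).map_eq)
  have hshear : MeasurePreserving (fun p : B × Ω => (p.1 - u p.2, p.2)) (μ.prod τ) (μ.prod τ) :=
    Measure.measurePreserving_swap.comp (hskew.comp Measure.measurePreserving_swap)
  conv_rhs => rw [← hshear.map_eq, Measure.map_map hf hshear.measurable]
  rfl

/-- Translation invariance of `μ` keeps the law of `(b, ω)` unchanged when `b` is replaced by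
`b - u ω`, so that the observation `φ (b - u, w)` is independent of `u` as soon as `w` is. -/
theorem isCondLaw_fst_of_isAddRightInvariant [SigmaFinite μ] [IsProbabilityMeasure τ]
    {g : G → B} (hu : Measurable u) (hw : Measurable w) (hφ : Measurable φ)
    (hg : Measurable g) (h : IndepFun w u τ) (hgφ : ∀ b ω, g (φ (b, w ω)) = b) :
    IsCondLaw (μ.prod τ) Prod.fst (fun p => φ (p.1 - u p.2, w p.2))
      (fun y => (τ.map u).map (fun b => g y + b)) := by
  have hY : Measurable fun p : B × Ω => φ (p.1 - u p.2, w p.2) := by fun_prop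
  have := Measure.isProbabilityMeasure_map (μ := τ) hu.aemeasurable
  have hσ : SigmaFinite ((μ.prod τ).map fun p => φ (p.1 - u p.2, w p.2)) := by
    refine SigmaFinite.of_map _ hg.aemeasurable ?_
    rw [Measure.map_map hg hY]
    simp only [Function.comp_def, hgφ]
    rw [map_comp_prod_sub hu measurable_fst, ← Measure.fst, Measure.fst_prod]
    infer_instance
  refine isCondLaw_of_map_residual_eq_prod measurable_fst hY hg hσ ?_
  simp only [hgφ, sub_sub_cancel]
  rw [map_comp_prod_sub hu (f := fun p => (φ (p.1, w p.2), u p.2)) (by fun_prop),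
    map_comp_prod_sub hu (f := fun p => φ (p.1, w p.2)) (by fun_prop),
    map_prodMk_eq_prod_of_indepFun hu hw hφ h]

end TranslationInvariance

end Disintegration

section GaussianVectors

variable {Ω ι κ : Type*} [MeasurableSpace Ω] {P : Measure Ω}

/-- `X` is a (possibly degenerate) Gaussian vector with mean `m` and covariance matrix `C`. -/
structure IsGaussianVector (X : Ω → ι → ℝ) (m : ι → ℝ) (C : Matrix ι ι ℝ) (P : Measure Ω) :
    Prop where
  hasGaussianLaw : HasGaussianLaw X P
  integral_eq : ∀ i, ∫ ω, X ω i ∂P = m i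
  covariance_eq : ∀ i j, cov[fun ω => X ω i, fun ω => X ω j; P] = C i j

lemma hasGaussianLaw_add_const {E : Type*} [NormedAddCommGroup E] [NormedSpace ℝ E]
    [MeasurableSpace E] [BorelSpace E] [CompleteSpace E] [SecondCountableTopology E]
    {X : Ω → E} (hX : HasGaussianLaw X P) (c : E) : HasGaussianLaw (fun ω => X ω + c) P where
  isGaussian_map := by
    have := hX.isGaussian_map
    have hmap : P.map (fun ω => X ω + c) = (P.map X).map (fun x => x + c) := by
      rw [AEMeasurable.map_map_of_aemeasurable (by fun_prop) hX.aemeasurable]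
      rfl
    rw [hmap]
    infer_instance

lemma hasGaussianLaw_linearMap {E F : Type*} [NormedAddCommGroup E] [NormedSpace ℝ E]
    [FiniteDimensional ℝ E] [MeasurableSpace E] [BorelSpace E] [NormedAddCommGroup F]
    [NormedSpace ℝ F] [MeasurableSpace F] [BorelSpace F] {X : Ω → E} (hX : HasGaussianLaw X P)
    (L : E →ₗ[ℝ] F) : HasGaussianLaw (fun ω => L (X ω)) P :=
  hX.map_fun L.toContinuousLinearMap

lemma multivariateGaussian_map_const_add [Fintype ι] [DecidableEq ι] (a m : EuclideanSpace ℝ ι)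
    (C : Matrix ι ι ℝ) :
    (multivariateGaussian m C).map (fun x => a + x) = multivariateGaussian (a + m) C := by
  simp only [multivariateGaussian]
  rw [Measure.map_map (by fun_prop) (by fun_prop)]
  simp only [Function.comp_def, add_assoc]

lemma sub_replicateRow_mul_mul_transpose [Fintype κ] (v : ℝ) (t : κ → ℝ) (N : Matrix κ κ ℝ) :
    (of fun _ _ => v) - replicateRow Unit t * N * (replicateRow Unit t)ᵀ =
      of fun _ _ => v - t ⬝ᵥ N *ᵥ t := by
  ext i j
  rw [Matrix.sub_apply, ← replicateRow_vecMul, transpose_replicateRow,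
    replicateRow_mul_replicateCol_apply, ← dotProduct_mulVec, of_apply, of_apply]

lemma replicateRow_mul_mulVec [Fintype κ] (t : κ → ℝ) (N : Matrix κ κ ℝ) (y : κ → ℝ) :
    (replicateRow Unit t * N) *ᵥ y = Function.const Unit (t ⬝ᵥ N *ᵥ y) := by
  rw [← replicateRow_vecMul, replicateRow_mulVec_eq_const, ← dotProduct_mulVec]

namespace IsGaussianVector

variable {X : Ω → ι → ℝ} {m : ι → ℝ} {C : Matrix ι ι ℝ}

lemma isProbabilityMeasure (hX : IsGaussianVector X m C P) : IsProbabilityMeasure P :=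
  hX.hasGaussianLaw.isProbabilityMeasure

lemma memLp_two (hX : IsGaussianVector X m C P) (i : ι) : MemLp (fun ω => X ω i) 2 P :=
  (hX.hasGaussianLaw.eval i).memLp_two

lemma integrable_const_mul (hX : IsGaussianVector X m C P) (a : ℝ) (i : ι) :
    Integrable (fun ω => a * X ω i) P :=
  have := hX.isProbabilityMeasure
  ((hX.memLp_two i).integrable (by norm_num)).const_mul a

theorem comp_measurePreserving {Ω' : Type*} [MeasurableSpace Ω'] {P' : Measure Ω'} {φ : Ω' → Ω}
    (hX : IsGaussianVector X m C P) (hφ : MeasurePreserving φ P' P) :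
    IsGaussianVector (fun ω => X (φ ω)) m C P' where
  hasGaussianLaw := by
    have := hX.hasGaussianLaw.isGaussian_map
    have hmX : AEMeasurable X (P'.map φ) := hφ.map_eq.symm ▸ hX.hasGaussianLaw.aemeasurable
    refine ⟨?_⟩
    rwa [← Function.comp_def X φ, ← AEMeasurable.map_map_of_aemeasurable hmX hφ.aemeasurable,
      hφ.map_eq]
  integral_eq i := by
    rw [← hX.integral_eq, ← hφ.map_eq, integral_map hφ.aemeasurable]
    rw [hφ.map_eq]
    exact (hX.memLp_two i).aestronglyMeasurable
  covariance_eq i j := by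
    rw [← hX.covariance_eq, ← hφ.map_eq, covariance_map_fun _ _ hφ.aemeasurable] <;>
    rw [hφ.map_eq]
    exacts [(hX.memLp_two i).aestronglyMeasurable, (hX.memLp_two j).aestronglyMeasurable]

section Moments

variable [Fintype ι]

lemma integral_dotProduct_add (hX : IsGaussianVector X m C P) (a : ι → ℝ) (c : ℝ) :
    ∫ ω, (a ⬝ᵥ X ω + c) ∂P = a ⬝ᵥ m + c := by
  have := hX.isProbabilityMeasure
  simp only [dotProduct]
  rw [integral_add (integrable_finsetSum _ fun i _ => hX.integrable_const_mul (a i) i)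
    (integrable_const c), integral_finsetSum _ fun i _ => hX.integrable_const_mul (a i) i]
  simp only [integral_const_mul, hX.integral_eq, integral_const, probReal_univ, one_smul]

lemma covariance_dotProduct_add (hX : IsGaussianVector X m C P) (a b : ι → ℝ) (c c' : ℝ) :
    cov[fun ω => a ⬝ᵥ X ω + c, fun ω => b ⬝ᵥ X ω + c'; P] = a ⬝ᵥ C *ᵥ b := by
  have := hX.isProbabilityMeasure
  have hint (a : ι → ℝ) : Integrable (fun ω => a ⬝ᵥ X ω) P :=
    integrable_finsetSum _ fun i _ => hX.integrable_const_mul (a i) i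
  rw [covariance_add_const_left (hint a), covariance_add_const_right (hint b)]
  simp only [dotProduct]
  rw [covariance_fun_sum_fun_sum (fun i => (hX.memLp_two i).const_mul (a i))
    (fun i => (hX.memLp_two i).const_mul (b i))]
  simp only [covariance_const_mul_left, covariance_const_mul_right, hX.covariance_eq, mulVec,
    dotProduct, Finset.mul_sum]
  exact Finset.sum_congr rfl fun i _ => Finset.sum_congr rfl fun j _ => by ring

theorem mulVec_add [Finite κ] (hX : IsGaussianVector X m C P) (M : Matrix κ ι ℝ) (c : κ → ℝ) :
    IsGaussianVector (fun ω => M *ᵥ X ω + c) (M *ᵥ m + c) (M * C * Mᵀ) P where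
  hasGaussianLaw := by
    cases nonempty_fintype κ
    exact hasGaussianLaw_add_const (hasGaussianLaw_linearMap hX.hasGaussianLaw M.mulVecLin) c
  integral_eq i := hX.integral_dotProduct_add (M i) (c i)
  covariance_eq i j := by
    refine (hX.covariance_dotProduct_add (M i) (M j) (c i) (c j)).trans ?_
    rw [Matrix.mul_assoc]
    simp only [mulVec, dotProduct, mul_apply, transpose_apply]

theorem map_dotProduct_add (hX : IsGaussianVector X m C P) (a : ι → ℝ) (c : ℝ) :
    P.map (fun ω => a ⬝ᵥ X ω + c) = gaussianReal (a ⬝ᵥ m + c) (a ⬝ᵥ C *ᵥ a).toNNReal := by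
  have hg : HasGaussianLaw (fun ω => a ⬝ᵥ X ω + c) P :=
    (hX.mulVec_add (Matrix.of fun _ : Unit => a) fun _ => c).hasGaussianLaw.eval ()
  rw [hg.map_eq_gaussianReal, ← covariance_self hg.aemeasurable, hX.covariance_dotProduct_add,
    hX.integral_dotProduct_add]

end Moments

variable {Y : Ω → κ → ℝ} {n : κ → ℝ} {D : Matrix κ κ ℝ}

section Finite

variable [Finite ι]

theorem posSemidef (hX : IsGaussianVector X m C P) : C.PosSemidef := by
  cases nonempty_fintype ι
  refine Matrix.PosSemidef.of_dotProduct_mulVec_nonneg ?_ fun a => ?_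
  · ext i j
    simp [← hX.covariance_eq, covariance_comm]
  · have hmeas (i : ι) := (hX.memLp_two i).aestronglyMeasurable.aemeasurable
    rw [star_trivial, ← hX.covariance_dotProduct_add a a 0 0, covariance_self]
    · exact variance_nonneg _ _
    · simp only [dotProduct]
      fun_prop

lemma transpose_covariance (hX : IsGaussianVector X m C P) : Cᵀ = C := by
  simpa using hX.posSemidef.isHermitian.eq

variable [Finite κ]

theorem comp (hX : IsGaussianVector X m C P) (e : κ → ι) :
    IsGaussianVector (fun ω i => X ω (e i)) (fun i => m (e i)) (C.submatrix e e) P where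
  hasGaussianLaw := by
    cases nonempty_fintype ι
    cases nonempty_fintype κ
    exact hasGaussianLaw_linearMap hX.hasGaussianLaw (LinearMap.funLeft ℝ ℝ e)
  integral_eq i := hX.integral_eq (e i)
  covariance_eq i j := hX.covariance_eq (e i) (e j)

theorem indepFun_of_sumElim {m : ι ⊕ κ → ℝ}
    (h : IsGaussianVector (fun ω => Sum.elim (X ω) (Y ω)) m (fromBlocks C 0 0 D) P) :
    IndepFun X Y P := by
  cases nonempty_fintype ι
  cases nonempty_fintype κ
  have hXY : HasGaussianLaw (fun ω => (X ω, Y ω)) P :=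
    hasGaussianLaw_linearMap h.hasGaussianLaw
      (LinearEquiv.sumArrowLequivProdArrow ι κ ℝ ℝ).toLinearMap
  exact HasGaussianLaw.indepFun_of_covariance_eval (X := fun i ω => X ω i)
    (Y := fun j ω => Y ω j) hXY fun i j => h.covariance_eq (Sum.inl i) (Sum.inr j)

theorem sumElim (hX : IsGaussianVector X m C P) (hY : IsGaussianVector Y n D P)
    (hXY : IndepFun X Y P) :
    IsGaussianVector (fun ω => Sum.elim (X ω) (Y ω)) (Sum.elim m n) (fromBlocks C 0 0 D) P where
  hasGaussianLaw := by
    cases nonempty_fintype ι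
    cases nonempty_fintype κ
    exact hasGaussianLaw_linearMap (hXY.hasGaussianLaw hX.hasGaussianLaw hY.hasGaussianLaw)
      (LinearEquiv.sumArrowLequivProdArrow ι κ ℝ ℝ).symm.toLinearMap
  integral_eq := by
    rintro (i | j)
    exacts [hX.integral_eq i, hY.integral_eq j]
  covariance_eq := by
    have hcov (i : ι) (j : κ) : cov[fun ω => X ω i, fun ω => Y ω j; P] = 0 :=
      (hXY.comp (measurable_pi_apply i) (measurable_pi_apply j)).covariance_eq_zero
        (hX.memLp_two i) (hY.memLp_two j)
    rintro (i | i) (j | j)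
    exacts [hX.covariance_eq i j, hcov i j, covariance_comm _ _ |>.trans (hcov j i),
      hY.covariance_eq i j]

end Finite

theorem map_toLp [Fintype ι] [DecidableEq ι] (hX : IsGaussianVector X m C P) :
    P.map (fun ω => WithLp.toLp 2 (X ω)) = multivariateGaussian (WithLp.toLp 2 m) C := by
  have := hX.isProbabilityMeasure
  have hXL : HasGaussianLaw (fun ω => WithLp.toLp 2 (X ω)) P := hX.hasGaussianLaw.toLp_pi 2
  have := hXL.isGaussian_map
  apply IsGaussian.ext
  · rw [integral_map hXL.aemeasurable (by fun_prop)]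
    simp only [id_eq, integral_id_multivariateGaussian]
    ext i
    exact ((EuclideanSpace.proj (𝕜 := ℝ) i).integral_comp_comm hXL.integrable).symm.trans
      (hX.integral_eq i)
  · rw [← ContinuousLinearMap.toBilinForm_inj]
    refine LinearMap.BilinForm.ext_basis (EuclideanSpace.basisFun ι ℝ).toBasis fun i j => ?_
    rw [ContinuousLinearMap.toBilinForm_apply, ContinuousLinearMap.toBilinForm_apply,
      covarianceBilin_multivariateGaussian hX.posSemidef, OrthonormalBasis.coe_toBasis,
      covarianceBilin_apply_basisFun hX.memLp_two, hX.covariance_eq]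
    simp

theorem add [Finite ι] {Y : Ω → ι → ℝ} {n : ι → ℝ} {D : Matrix ι ι ℝ}
    (hX : IsGaussianVector X m C P) (hY : IsGaussianVector Y n D P) (hXY : IndepFun X Y P) :
    IsGaussianVector (fun ω => X ω + Y ω) (m + n) (C + D) P := by
  classical
  cases nonempty_fintype ι
  have h := (hX.sumElim hY hXY).mulVec_add (fromCols (1 : Matrix ι ι ℝ) (1 : Matrix ι ι ℝ)) 0
  simpa only [fromCols_mulVec_sumElim, one_mulVec, add_zero, fromCols_mul_fromBlocks,
    Matrix.one_mul, Matrix.mul_zero, zero_add, transpose_fromCols, fromCols_mul_fromRows,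
    transpose_one, Matrix.mul_one] using h

variable [Fintype κ]

/-- The residual `X - K Y` is uncorrelated with `Y` as soon as `K Cov(Y) = Cov(X, Y)`; when
`Cov(Y)` is invertible this forces `K = Cov(X, Y) Cov(Y)⁻¹`. -/
theorem residual [Finite ι] {B : Matrix ι κ ℝ}
    (h : IsGaussianVector (fun ω => Sum.elim (X ω) (Y ω)) (Sum.elim m n)
      (fromBlocks C B Bᵀ D) P) {K : Matrix ι κ ℝ} (hK : K * D = B) :
    IsGaussianVector (fun ω => Sum.elim (X ω - K *ᵥ Y ω) (Y ω)) (Sum.elim (m - K *ᵥ n) n)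
      (fromBlocks (C - K * Bᵀ) 0 0 D) P := by
  classical
  cases nonempty_fintype ι
  have hDK : D * Kᵀ = Bᵀ := by
    have hDsymm : Dᵀ = D := (h.comp Sum.inr).transpose_covariance
    rw [← hK, transpose_mul, hDsymm]
  have hT := h.mulVec_add (fromBlocks 1 (-K) 0 (1 : Matrix κ κ ℝ)) 0
  simpa [fromBlocks_mulVec, fromBlocks_multiply, fromBlocks_transpose, hK, hDK, neg_mulVec,
    ← sub_eq_add_neg] using hT

lemma posSemidef_condCov [Finite ι] {B : Matrix ι κ ℝ}
    (h : IsGaussianVector (fun ω => Sum.elim (X ω) (Y ω)) (Sum.elim m n)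
      (fromBlocks C B Bᵀ D) P) {K : Matrix ι κ ℝ} (hK : K * D = B) :
    (C - K * Bᵀ).PosSemidef :=
  ((h.residual hK).comp Sum.inl).posSemidef

theorem isCondLaw [Fintype ι] [DecidableEq ι] {B : Matrix ι κ ℝ}
    (h : IsGaussianVector (fun ω => Sum.elim (X ω) (Y ω)) (Sum.elim m n)
      (fromBlocks C B Bᵀ D) P) (hXm : Measurable X) (hYm : Measurable Y) {K : Matrix ι κ ℝ}
    (hK : K * D = B) :
    IsCondLaw P (fun ω => WithLp.toLp 2 (X ω)) Y fun y =>
      multivariateGaussian (WithLp.toLp 2 (m + K *ᵥ (y - n))) (C - K * Bᵀ) := by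
  have := h.isProbabilityMeasure
  have hres := h.residual hK
  have hindep : IndepFun Y (fun ω => WithLp.toLp 2 (X ω) - WithLp.toLp 2 (K *ᵥ Y ω)) P :=
    hres.indepFun_of_sumElim.symm.comp measurable_id (WithLp.measurable_toLp 2 _)
  have hlaw : P.map (fun ω => WithLp.toLp 2 (X ω) - WithLp.toLp 2 (K *ᵥ Y ω)) =
      multivariateGaussian (WithLp.toLp 2 (m - K *ᵥ n)) (C - K * Bᵀ) :=
    (hres.comp Sum.inl).map_toLp
  have hcond := isCondLaw_of_indepFun_residual (X := fun ω => WithLp.toLp 2 (X ω))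
    (g := fun y => WithLp.toLp 2 (K *ᵥ y)) (by fun_prop) hYm (by fun_prop) hindep
  have hmean (y : κ → ℝ) : m + K *ᵥ (y - n) = K *ᵥ y + (m - K *ᵥ n) := by
    rw [mulVec_sub]
    abel
  simpa only [hlaw, multivariateGaussian_map_const_add, ← WithLp.toLp_add, ← hmean] using hcond

section Kriging

variable [DecidableEq κ] {W : Ω → ℝ} {w v : ℝ} {t : κ → ℝ}

theorem krigingVar_nonneg
    (h : IsGaussianVector (fun ω => Sum.elim (fun _ : Unit => W ω) (Y ω))
      (Sum.elim (fun _ => w) n)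
      (fromBlocks (of fun _ _ => v) (replicateRow Unit t) (replicateCol Unit t) D) P)
    (hD : IsUnit D.det) : 0 ≤ v - t ⬝ᵥ D⁻¹ *ᵥ t := by
  have hpos := h.posSemidef_condCov (nonsing_inv_mul_cancel_right (A := D) _ hD)
  rw [sub_replicateRow_mul_mul_transpose] at hpos
  exact hpos.diag_nonneg (i := ())

theorem isCondLaw_kriging
    (h : IsGaussianVector (fun ω => Sum.elim (fun _ : Unit => W ω) (Y ω))
      (Sum.elim (fun _ => w) n)
      (fromBlocks (of fun _ _ => v) (replicateRow Unit t) (replicateCol Unit t) D) P)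
    (hWm : Measurable W) (hYm : Measurable Y) (hD : IsUnit D.det) :
    IsCondLaw P W Y fun y =>
      gaussianReal (w + t ⬝ᵥ D⁻¹ *ᵥ (y - n)) (v - t ⬝ᵥ D⁻¹ *ᵥ t).toNNReal := by
  have hK := nonsing_inv_mul_cancel_right (A := D) (replicateRow Unit t) hD
  have hpos := h.posSemidef_condCov hK
  have hcond := (h.isCondLaw (by fun_prop) hYm hK).map (by fun_prop) hYm
    (f := fun x => x ()) (by fun_prop)
  rw [sub_replicateRow_mul_mul_transpose] at hpos
  simpa only [sub_replicateRow_mul_mul_transpose, replicateRow_mul_mulVec, Pi.add_apply,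
    Function.const_apply, of_apply, (measurePreserving_eval_multivariateGaussian hpos).map_eq]
    using hcond

end Kriging

end IsGaussianVector

theorem isGaussianVector_multivariateGaussian [Fintype ι] [DecidableEq ι] (m : ι → ℝ)
    {C : Matrix ι ι ℝ} (hC : C.PosSemidef) :
    IsGaussianVector WithLp.ofLp m C (multivariateGaussian (WithLp.toLp 2 m) C) where
  hasGaussianLaw := hasGaussianLaw_linearMap IsGaussian.hasGaussianLaw_id
    (WithLp.linearEquiv 2 ℝ (ι → ℝ)).toLinearMap
  integral_eq i := by
    have h := (EuclideanSpace.proj (𝕜 := ℝ) i).integral_comp_comm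
      (IsGaussian.integrable_id (μ := multivariateGaussian (WithLp.toLp 2 m) C))
    simpa using h
  covariance_eq := covariance_eval_multivariateGaussian hC

theorem isGaussianVector_of_isGaussianProcess [Finite ι] {T : Type*} {Z : T → Ω → ℝ}
    (hZ : IsGaussianProcess Z P) (x : ι → T) :
    IsGaussianVector (fun ω i => Z (x i) ω) (fun i => ∫ ω, Z (x i) ω ∂P)
      (of fun i j => cov[Z (x i), Z (x j); P]) P where
  hasGaussianLaw := by
    classical
    cases nonempty_fintype ι
    exact hasGaussianLaw_linearMap (hZ.hasGaussianLaw (Finset.univ.image x))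
      (LinearMap.funLeft ℝ ℝ fun i =>
        (⟨x i, Finset.mem_image_of_mem x (Finset.mem_univ i)⟩ : Finset.univ.image x))
  integral_eq _ := rfl
  covariance_eq _ _ := rfl

theorem multivariateGaussian_bind_gaussianReal [Fintype ι] [DecidableEq ι] (m : ι → ℝ)
    {C : Matrix ι ι ℝ} (hC : C.PosSemidef) (a : ι → ℝ) (c : ℝ) (v : NNReal) :
    (multivariateGaussian (WithLp.toLp 2 m) C).bind
        (fun β => gaussianReal (a ⬝ᵥ β.ofLp + c) v) =
      gaussianReal (a ⬝ᵥ m + c) ((a ⬝ᵥ C *ᵥ a).toNNReal + v) := by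
  have hg : Measurable fun β : EuclideanSpace ℝ ι => a ⬝ᵥ β.ofLp + c := by
    simp only [dotProduct]
    fun_prop
  have hkernel : (fun β : EuclideanSpace ℝ ι => gaussianReal (a ⬝ᵥ β.ofLp + c) v) =
      translationKernel (gaussianReal 0 v) fun β => a ⬝ᵥ β.ofLp + c := by
    ext1 β
    rw [translationKernel_apply hg, gaussianReal_map_const_add, zero_add]
  rw [hkernel, bind_translationKernel hg,
    (isGaussianVector_multivariateGaussian m hC).map_dotProduct_add a c,
    gaussianReal_conv_gaussianReal, add_zero]

end GaussianVectors

section LinearModel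

variable {Ω ι κ : Type*} [MeasurableSpace Ω] [Fintype κ] {Y : Ω → κ → ℝ}
  {H : Matrix κ ι ℝ} {G : Matrix ι κ ℝ} {V : Matrix κ κ ℝ}

lemma posSemidef_mul_of_mul_eq_transpose [Finite ι] (hV : V.PosSemidef) (hG : G * V = Hᵀ) :
    (G * H).PosSemidef := by
  have hVT : Vᵀ = V := by simpa using hV.isHermitian.eq
  have hGH : G * V * Gᵀ = G * H := by
    rw [Matrix.mul_assoc, ← hVT, ← transpose_mul, hG, transpose_transpose]
  simpa [hGH] using hV.mul_mul_conjTranspose_same G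

variable [Fintype ι] {c : κ → ℝ} {P : Kernel (EuclideanSpace ℝ ι) Ω}

lemma compProd_map_eq_prod_multivariateGaussian_map [DecidableEq κ] [IsSFiniteKernel P]
    {π : Measure (EuclideanSpace ℝ ι)} [SFinite π] (hYm : Measurable Y)
    (hY : ∀ β, IsGaussianVector Y (H *ᵥ β.ofLp + c) V (P β)) :
    (π ⊗ₘ P).map (fun q => (Y q.2, q.1)) =
      (π.prod (multivariateGaussian 0 V)).map
        (fun p => (H *ᵥ p.1.ofLp + c + p.2.ofLp, p.1)) := by
  have hlaw := compProd_map_eq_prod_map (π := π) (τ := multivariateGaussian 0 V)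
    (Y := fun ω => WithLp.toLp 2 (Y ω)) (a := fun β => WithLp.toLp 2 (H *ᵥ β.ofLp + c))
    (by fun_prop) (by fun_prop) fun β => by
      rw [(hY β).map_toLp, multivariateGaussian_map_const_add, add_zero]
  have hswap := congrArg (Measure.map fun q : EuclideanSpace ℝ ι × EuclideanSpace ℝ κ =>
    (q.2.ofLp, q.1)) hlaw
  rwa [Measure.map_map (by fun_prop) (by fun_prop),
    Measure.map_map (by fun_prop) (by fun_prop)] at hswap

variable [DecidableEq ι]

lemma isGaussianVector_sumElim_linearModel [DecidableEq κ] (hV : V.PosSemidef) (b : ι → ℝ)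
    {S : Matrix ι ι ℝ} (hS : S.PosSemidef) :
    IsGaussianVector (fun p : EuclideanSpace ℝ ι × EuclideanSpace ℝ κ =>
        Sum.elim p.1.ofLp (H *ᵥ p.1.ofLp + c + p.2.ofLp))
      (Sum.elim b (H *ᵥ b + c)) (fromBlocks S (S * Hᵀ) (S * Hᵀ)ᵀ (H * S * Hᵀ + V))
      ((multivariateGaussian (WithLp.toLp 2 b) S).prod (multivariateGaussian 0 V)) := by
  have hprior := (isGaussianVector_multivariateGaussian b hS).comp_measurePreserving
    (measurePreserving_fst (ν := multivariateGaussian 0 V))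
  have hnoise := (isGaussianVector_multivariateGaussian 0 hV).comp_measurePreserving
    (measurePreserving_snd (μ := multivariateGaussian (WithLp.toLp 2 b) S))
  have hjoint := (hprior.sumElim hnoise (indepFun_prod (by fun_prop) (by fun_prop))).mulVec_add
    (fromBlocks (1 : Matrix ι ι ℝ) 0 H 1) (Sum.elim 0 c)
  have hST : Sᵀ = S := by simpa using hS.isHermitian.eq
  simpa [fromBlocks_mulVec, fromBlocks_multiply, fromBlocks_transpose, ← Sum.elim_add_add,
    add_right_comm, hST] using hjoint

variable {A : Matrix ι ι ℝ}

theorem isCondLaw_linearModel_of_gaussianPrior [IsSFiniteKernel P] (hYm : Measurable Y)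
    (hY : ∀ β, IsGaussianVector Y (H *ᵥ β.ofLp + c) V (P β)) (hG : G * V = Hᵀ) (b : ι → ℝ)
    {S : Matrix ι ι ℝ} (hS : S.PosDef) (hA : A * (G * H + S⁻¹) = 1) :
    IsCondLaw (multivariateGaussian (WithLp.toLp 2 b) S ⊗ₘ P) Prod.fst (fun q => Y q.2) fun y =>
      multivariateGaussian (WithLp.toLp 2 (A *ᵥ (G *ᵥ (y - c) + S⁻¹ *ᵥ b))) A := by
  classical
  have hSinv : S⁻¹ * S = 1 := nonsing_inv_mul _ ((isUnit_iff_isUnit_det S).1 hS.isUnit)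
  have hAS : A * (G * H * S + 1) = S := by
    rw [← hSinv, ← Matrix.add_mul, ← Matrix.mul_assoc, hA, Matrix.one_mul]
  have hgain : A * G * (H * S * Hᵀ + V) = S * Hᵀ := by
    calc A * G * (H * S * Hᵀ + V) = A * (G * H * S + 1) * Hᵀ := by
          simp only [Matrix.mul_add, Matrix.add_mul, Matrix.mul_assoc, hG, Matrix.one_mul]
      _ = S * Hᵀ := by rw [hAS]
  have hcov : S - A * G * (S * Hᵀ)ᵀ = A := by
    have hST : Sᵀ = S := by simpa using hS.isHermitian.eq
    rw [transpose_mul, transpose_transpose, hST, sub_eq_iff_eq_add']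
    conv_lhs => rw [← hAS]
    simp only [Matrix.mul_add, Matrix.mul_one, Matrix.mul_assoc]
  have hmean (y : κ → ℝ) :
      b + (A * G) *ᵥ (y - (H *ᵥ b + c)) = A *ᵥ (G *ᵥ (y - c) + S⁻¹ *ᵥ b) := by
    have hb : b = A *ᵥ (G *ᵥ H *ᵥ b + S⁻¹ *ᵥ b) := by
      rw [mulVec_mulVec, ← add_mulVec, mulVec_mulVec, hA, one_mulVec]
    rw [← mulVec_mulVec, ← sub_sub, sub_right_comm]
    nth_rw 1 [hb]
    rw [← mulVec_add]
    congr 1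
    rw [mulVec_sub G (y - c)]
    abel
  have hcond := (isGaussianVector_sumElim_linearModel (c := c) (hY 0).posSemidef b
    hS.posSemidef).isCondLaw (by fun_prop) (by fun_prop) hgain
  simp only [hcov, hmean, WithLp.toLp_ofLp] at hcond
  exact hcond.of_map_eq measurable_fst measurable_fst
    (compProd_map_eq_prod_multivariateGaussian_map hYm hY)

variable {K : Matrix ι κ ℝ}

/-- `K` is the generalized least squares estimator of `β`: its error `-K e` is independent of the
residuals `(1 - H K) e`. -/
lemma isGaussianVector_sumElim_residual [DecidableEq κ] (hV : V.PosSemidef) (hKH : K * H = 1)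
    (hKV : K * V = A * Hᵀ) :
    IsGaussianVector (fun e : EuclideanSpace ℝ κ =>
        Sum.elim ((1 - H * K) *ᵥ e.ofLp) (-K *ᵥ e.ofLp)) (Sum.elim 0 0)
      (fromBlocks ((1 - H * K) * V * (1 - H * K)ᵀ) 0 0 A) (multivariateGaussian 0 V) := by
  have hVT : Vᵀ = V := by simpa using hV.isHermitian.eq
  have hvar : K * V * Kᵀ = A := by
    rw [hKV, Matrix.mul_assoc, ← transpose_mul, hKH, transpose_one, Matrix.mul_one]
  have hcross : K * V * (1 - H * K)ᵀ = 0 := by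
    rw [transpose_sub, Matrix.mul_sub, transpose_one, Matrix.mul_one, transpose_mul,
      ← Matrix.mul_assoc, hvar, hKV, sub_self]
  have hcrossT : (1 - H * K) * V * Kᵀ = 0 := by
    simpa only [transpose_mul, transpose_transpose, transpose_zero, hVT, Matrix.mul_assoc] using
      congrArg transpose hcross
  have h := (isGaussianVector_multivariateGaussian 0 hV).mulVec_add
    (fromRows (1 - H * K) (-K)) 0
  rw [fromRows_mul, transpose_fromRows, fromRows_mul_fromCols] at h
  simpa only [fromRows_mulVec, transpose_neg, Matrix.neg_mul, Matrix.mul_neg, neg_neg, hvar,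
    hcross, hcrossT, mulVec_zero, add_zero, neg_zero, WithLp.toLp_zero, Sum.elim_zero_zero]
    using h

theorem isCondLaw_linearModel_of_flatPrior [IsSFiniteKernel P] (hYm : Measurable Y)
    (hY : ∀ β, IsGaussianVector Y (H *ᵥ β.ofLp + c) V (P β)) (hKH : K * H = 1)
    (hKV : K * V = A * Hᵀ) :
    IsCondLaw (volume ⊗ₘ P) Prod.fst (fun q => Y q.2) fun y =>
      multivariateGaussian (WithLp.toLp 2 (K *ᵥ (y - c))) A := by
  classical
  have hres := isGaussianVector_sumElim_residual (hY 0).posSemidef hKH hKV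
  have hestimate (b : EuclideanSpace ℝ ι) (e : EuclideanSpace ℝ κ) :
      K *ᵥ (H *ᵥ b.ofLp + c + (1 - H * K) *ᵥ e.ofLp - c) = b.ofLp := by
    rw [add_right_comm, add_sub_cancel_right, mulVec_add, mulVec_mulVec, mulVec_mulVec,
      Matrix.mul_sub, ← Matrix.mul_assoc, hKH, Matrix.mul_one, Matrix.one_mul, sub_self,
      zero_mulVec, one_mulVec, add_zero]
  have hobs (b : EuclideanSpace ℝ ι) (e : EuclideanSpace ℝ κ) :
      H *ᵥ (b - WithLp.toLp 2 (-K *ᵥ e.ofLp)).ofLp + c + (1 - H * K) *ᵥ e.ofLp =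
        H *ᵥ b.ofLp + c + e.ofLp := by
    rw [WithLp.ofLp_sub, mulVec_sub, sub_mulVec, one_mulVec, neg_mulVec, mulVec_neg, mulVec_mulVec]
    abel
  have herror : (multivariateGaussian 0 V).map (fun e => WithLp.toLp 2 (-K *ᵥ e.ofLp)) =
      multivariateGaussian 0 A :=
    (hres.comp Sum.inr).map_toLp
  have hcond := isCondLaw_fst_of_isAddRightInvariant
    (μ := (volume : Measure (EuclideanSpace ℝ ι))) (τ := multivariateGaussian 0 V)
    (u := fun e => WithLp.toLp 2 (-K *ᵥ e.ofLp)) (w := fun e => (1 - H * K) *ᵥ e.ofLp)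
    (φ := fun p => H *ᵥ p.1.ofLp + c + p.2) (g := fun y => WithLp.toLp 2 (K *ᵥ (y - c)))
    (by fun_prop) (by fun_prop) (by fun_prop) (by fun_prop)
    (hres.indepFun_of_sumElim.comp measurable_id (WithLp.measurable_toLp 2 _))
    fun b e => congrArg (WithLp.toLp 2) (hestimate b e)
  simp only [hobs, herror, multivariateGaussian_map_const_add, add_zero] at hcond
  exact hcond.of_map_eq measurable_fst measurable_fst
    (compProd_map_eq_prod_multivariateGaussian_map hYm hY)

end LinearModel

lemma inv_mul_of_posDef_inv {ι : Type*} [Fintype ι] [DecidableEq ι] {M : Matrix ι ι ℝ}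
    (hM : M⁻¹.PosDef) : M⁻¹ * M = 1 :=
  nonsing_inv_mul _ ((isUnit_iff_isUnit_det _).1 (isUnit_nonsing_inv_iff.1 hM.isUnit))

namespace Setup

variable {d n₁ n₂ p₁ p₂ : ℕ} (S : Setup d n₁ n₂ p₁ p₂)

/-- The columns of `H` that multiply `β₁`. -/
def H₁ : Matrix (Fin n₁ ⊕ Fin n₂) (Fin p₁) ℝ :=
  fromRows S.F₁ (S.ρ • designMatrix S.f₁ S.D₂)

/-- The part of the mean of the observations that does not depend on `β₁`. -/
def offset : Fin n₁ ⊕ Fin n₂ → ℝ := Sum.elim 0 (designMatrix S.f₂ S.D₂ *ᵥ S.β₂)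

/-- The weights `(F₁ᵀ R₁⁻¹ / σ₁², 0)` of the observations in the score of `β₁`. -/
noncomputable def scoreMatrix : Matrix (Fin p₁) (Fin n₁ ⊕ Fin n₂) ℝ :=
  fromCols (S.F₁ᵀ * ((S.σ₁ ^ 2)⁻¹ • S.R₁⁻¹)) 0

lemma H_mulVec (β : Fin p₁ → ℝ) : S.H *ᵥ Sum.elim β S.β₂ = S.H₁ *ᵥ β + S.offset := by
  ext (i | i) <;> simp [H, H₁, offset, fromBlocks_mulVec]

lemma scoreMatrix_mulVec_sub_offset (z : Fin n₁ ⊕ Fin n₂ → ℝ) :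
    S.scoreMatrix *ᵥ (z - S.offset) =
      (S.F₁ᵀ * ((S.σ₁ ^ 2)⁻¹ • S.R₁⁻¹)) *ᵥ fun i => z (Sum.inl i) := by
  rw [scoreMatrix, fromCols_mulVec, zero_mulVec, add_zero]
  congr 1
  ext i
  simp [offset]

lemma scoreMatrix_mul_H₁ :
    S.scoreMatrix * S.H₁ = S.F₁ᵀ * ((S.σ₁ ^ 2)⁻¹ • S.R₁⁻¹) * S.F₁ := by
  rw [scoreMatrix, H₁, fromCols_mul_fromRows, Matrix.zero_mul, add_zero]

lemma exists_selectionMatrix : ∃ E : Matrix (Fin n₁) (Fin n₂) ℝ,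
    designMatrix S.f₁ S.D₂ = Eᵀ * S.F₁ ∧ corrMatrix S.r₁ S.D₁ S.D₂ = S.R₁ * E ∧
      corrMatrix S.r₁ S.D₂ S.D₁ = Eᵀ * S.R₁ ∧ corrMatrix S.r₁ S.D₂ S.D₂ = Eᵀ * S.R₁ * E := by
  choose e he using fun j => S.nested (Set.mem_range_self j)
  refine ⟨(1 : Matrix (Fin n₁) (Fin n₁) ℝ).submatrix id e, ?_, ?_, ?_, ?_⟩ <;>
  · ext i j
    simp [Matrix.mul_apply, one_apply, designMatrix, corrMatrix, F₁, R₁, he]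

/-- Block LDLᵀ factorization: as `D₂ ⊆ D₁`, subtracting `ρ` times the corresponding cheap
observations from the expensive ones leaves the observations of `δ`. -/
lemma exists_V_eq_mul_fromBlocks_mul_transpose : ∃ N : Matrix (Fin n₂) (Fin n₁) ℝ,
    S.H₁ = fromRows S.F₁ (N * S.F₁) ∧
      S.V = fromBlocks 1 0 N 1 * fromBlocks (S.σ₁ ^ 2 • S.R₁) 0 0 (S.σ₂ ^ 2 • S.R₂) *
        (fromBlocks 1 0 N 1)ᵀ := by
  obtain ⟨E, hF, h₁₂, h₂₁, h₂₂⟩ := S.exists_selectionMatrix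
  refine ⟨S.ρ • Eᵀ, ?_, ?_⟩
  · rw [H₁, hF, Matrix.smul_mul]
  · have hρ : S.ρ ^ 2 * S.σ₁ ^ 2 = S.ρ * (S.ρ * S.σ₁ ^ 2) := by ring
    simp [V, h₁₂, h₂₁, h₂₂, hρ, fromBlocks_transpose, fromBlocks_multiply, smul_smul,
      mul_comm (S.σ₁ ^ 2) S.ρ]

lemma isUnit_det_V (hR₁ : IsUnit S.R₁.det) (hR₂ : IsUnit S.R₂.det) : IsUnit S.V.det := by
  obtain ⟨N, -, hV⟩ := S.exists_V_eq_mul_fromBlocks_mul_transpose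
  rw [hV, det_mul, det_mul, det_transpose, det_fromBlocks_zero₁₂, det_fromBlocks_zero₁₂, det_smul,
    det_smul]
  simp [S.σ₁_pos.ne', S.σ₂_pos.ne', hR₁.ne_zero, hR₂.ne_zero]

lemma scoreMatrix_mul_V (hR₁ : IsUnit S.R₁.det) : S.scoreMatrix * S.V = S.H₁ᵀ := by
  obtain ⟨N, hH, hV⟩ := S.exists_V_eq_mul_fromBlocks_mul_transpose
  simp [hH, hV, scoreMatrix, fromBlocks_transpose, ← Matrix.mul_assoc, fromCols_mul_fromBlocks,
    transpose_fromRows, S.σ₁_pos.ne', nonsing_inv_mul_cancel_right _ _ hR₁]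

lemma posDef_priorCovariance {v : Fin p₁ → ℝ} (hv : ∀ i, 0 < v i) :
    (S.σ₁ ^ 2 • diagonal v).PosDef :=
  (PosDef.diagonal hv).smul (pow_pos S.σ₁_pos 2)

lemma inv_priorCovariance {v : Fin p₁ → ℝ} (hv : ∀ i, 0 < v i) :
    (S.σ₁ ^ 2 • diagonal v)⁻¹ = (S.σ₁ ^ 2)⁻¹ • (diagonal v)⁻¹ := by
  have := invertibleOfNonzero (pow_ne_zero 2 S.σ₁_pos.ne')
  rw [Matrix.inv_smul _ (S.σ₁ ^ 2) ((isUnit_iff_isUnit_det _).1 (PosDef.diagonal hv).isUnit),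
    invOf_eq_inv]

lemma A_informative (b v : Fin p₁ → ℝ) (hv : ∀ i, 0 < v i) :
    S.A (.informative b v hv) = (S.scoreMatrix * S.H₁ + (S.σ₁ ^ 2 • diagonal v)⁻¹)⁻¹ := by
  rw [A, scoreMatrix_mul_H₁, S.inv_priorCovariance hv]

lemma A_nonInformative : S.A .nonInformative = (S.scoreMatrix * S.H₁)⁻¹ := by
  rw [A, scoreMatrix_mul_H₁]

lemma postMean_informative (b v : Fin p₁ → ℝ) (hv : ∀ i, 0 < v i) (z : Fin n₁ ⊕ Fin n₂ → ℝ) :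
    S.postMean (.informative b v hv) z =
      S.A (.informative b v hv) *ᵥ
        (S.scoreMatrix *ᵥ (z - S.offset) + (S.σ₁ ^ 2 • diagonal v)⁻¹ *ᵥ b) := by
  rw [scoreMatrix_mulVec_sub_offset, S.inv_priorCovariance hv]
  rfl

lemma postMean_nonInformative (z : Fin n₁ ⊕ Fin n₂ → ℝ) :
    S.postMean .nonInformative z =
      (S.A .nonInformative * S.scoreMatrix) *ᵥ (z - S.offset) := by
  rw [← mulVec_mulVec, scoreMatrix_mulVec_sub_offset]
  rfl

lemma krigingMean_eq (x : S.Q) (β : Fin p₁ → ℝ) (z : Fin n₁ ⊕ Fin n₂ → ℝ) :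
    S.krigingMean x β z = S.k₁ x ⬝ᵥ β +
      ((fun j => S.k x (Sum.inr j)) ⬝ᵥ S.β₂ + S.t x ⬝ᵥ S.V⁻¹ *ᵥ z) := by
  have hk : S.k x ⬝ᵥ Sum.elim β S.β₂ =
      S.k₁ x ⬝ᵥ β + (fun j => S.k x (Sum.inr j)) ⬝ᵥ S.β₂ := by
    simp [dotProduct, k₁]
  rw [← add_assoc, ← hk, krigingMean, k, sub_dotProduct, mulVec_sub, dotProduct_sub,
    ← dotProduct_mulVec, mulVec_mulVec]
  ring

lemma measurable_krigingMean (x : S.Q) :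
    Measurable fun p : (Fin n₁ ⊕ Fin n₂ → ℝ) × EuclideanSpace ℝ (Fin p₁) =>
      S.krigingMean x p.2.ofLp p.1 := by
  simp only [krigingMean_eq, dotProduct]
  fun_prop

instance sigmaFinite_priorMeasure (π : Prior p₁) : SigmaFinite (S.priorMeasure π) := by
  cases π <;> simp only [priorMeasure] <;> infer_instance

namespace IsModel

variable {S} {Ω : Type*} [MeasurableSpace Ω]
  {Z₁ δ : S.Q → Ω → ℝ} {P : Kernel (EuclideanSpace ℝ (Fin p₁)) Ω}

lemma measurable_Z₂ (h : S.IsModel Z₁ δ P) (x : S.Q) : Measurable (S.Z₂ Z₁ δ x) :=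
  ((h.measurable_Z₁ x).const_mul _).add (h.measurable_δ x)

lemma measurable_obs (h : S.IsModel Z₁ δ P) : Measurable (S.obs Z₁ δ) := by
  refine measurable_pi_iff.2 ?_
  rintro (i | j)
  exacts [h.measurable_Z₁ _, h.measurable_Z₂ _]

lemma r₁_sub_comm (h : S.IsModel Z₁ δ P) (x y : S.Q) :
    S.r₁ ((x : EuclideanSpace ℝ (Fin d)) - y) = S.r₁ ((y : EuclideanSpace ℝ (Fin d)) - x) := by
  refine mul_left_cancel₀ (pow_ne_zero 2 S.σ₁_pos.ne') ?_
  rw [← h.cov_Z₁ 0, ← h.cov_Z₁ 0, covariance_comm]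

lemma r₂_sub_comm (h : S.IsModel Z₁ δ P) (x y : S.Q) :
    S.r₂ ((x : EuclideanSpace ℝ (Fin d)) - y) = S.r₂ ((y : EuclideanSpace ℝ (Fin d)) - x) := by
  refine mul_left_cancel₀ (pow_ne_zero 2 S.σ₂_pos.ne') ?_
  rw [← h.cov_δ 0, ← h.cov_δ 0, covariance_comm]

theorem isGaussianVector_mul_Z₁_add_mul_δ {ι : Type*} [Finite ι] (h : S.IsModel Z₁ δ P)
    (β : EuclideanSpace ℝ (Fin p₁)) (x : ι → S.Q) (a b : ι → ℝ) :
    IsGaussianVector (fun ω i => a i * Z₁ (x i) ω + b i * δ (x i) ω)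
      (fun i => a i * S.f₁ (x i) ⬝ᵥ β.ofLp + b i * S.f₂ (x i) ⬝ᵥ S.β₂)
      (of fun i j => a i * a j * (S.σ₁ ^ 2 * S.r₁ ((x i : EuclideanSpace ℝ (Fin d)) - x j)) +
        b i * b j * (S.σ₂ ^ 2 * S.r₂ ((x i : EuclideanSpace ℝ (Fin d)) - x j))) (P β) := by
  classical
  cases nonempty_fintype ι
  have hZ := (isGaussianVector_of_isGaussianProcess (h.gaussian_Z₁ β) x).mulVec_add (diagonal a) 0
  have hδ := (isGaussianVector_of_isGaussianProcess (h.gaussian_δ β) x).mulVec_add (diagonal b) 0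
  have hindep := (h.indep β).comp
    (φ := fun z => diagonal a *ᵥ (fun i => z (x i)) + 0)
    (ψ := fun z => diagonal b *ᵥ (fun i => z (x i)) + 0) (by fun_prop) (by fun_prop)
  have hsum := hZ.add hδ hindep
  simp only [h.mean_Z₁, h.mean_δ, h.cov_Z₁, h.cov_δ] at hsum
  convert hsum using 1
  · ext ω i
    simp [mulVec_diagonal]
  · ext i
    simp [mulVec_diagonal]
  · ext i j
    simp only [of_apply, Matrix.add_apply, diagonal_transpose, mul_diagonal, diagonal_mul]
    ring

theorem isGaussianVector_sumElim_Z₂_obs {κ : Type*} [Finite κ] (h : S.IsModel Z₁ δ P)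
    (β : EuclideanSpace ℝ (Fin p₁)) (x : κ → S.Q) :
    IsGaussianVector (fun ω => Sum.elim (fun i => S.Z₂ Z₁ δ (x i) ω) (S.obs Z₁ δ ω))
      (Sum.elim (fun i => S.h (x i) ⬝ᵥ Sum.elim β.ofLp S.β₂) (S.H *ᵥ Sum.elim β.ofLp S.β₂))
      (fromBlocks
        (of fun i j => S.ρ ^ 2 * S.σ₁ ^ 2 * S.r₁ ((x i : EuclideanSpace ℝ (Fin d)) - x j) +
          S.σ₂ ^ 2 * S.r₂ ((x i : EuclideanSpace ℝ (Fin d)) - x j))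
        (of fun i => S.t (x i)) (of fun i => S.t (x i))ᵀ S.V) (P β) := by
  have hjoint := h.isGaussianVector_mul_Z₁_add_mul_δ β (Sum.elim x (Sum.elim S.D₁ S.D₂))
    (Sum.elim (fun _ => S.ρ) (Sum.elim (fun _ => 1) fun _ => S.ρ))
    (Sum.elim (fun _ => 1) (Sum.elim (fun _ => 0) fun _ => 1))
  convert hjoint using 1
  · ext ω (i | i | i) <;> simp [Z₂, obs]
  · ext (i | i | i) <;>
    simp [Setup.h, H, F₁, designMatrix, mulVec, dotProduct, Finset.mul_sum, mul_assoc]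
  · ext (i | i | i) (j | j | j) <;>
    simp only [t, V, R₁, R₂, corrMatrix, of_apply, transpose_apply, Matrix.add_apply,
      Matrix.smul_apply, smul_eq_mul, fromBlocks_apply₁₁, fromBlocks_apply₁₂, fromBlocks_apply₂₁,
      fromBlocks_apply₂₂, Sum.elim_inl, Sum.elim_inr, h.r₁_sub_comm, h.r₂_sub_comm] <;>
    ring

theorem isGaussianVector_obs (h : S.IsModel Z₁ δ P) (β : EuclideanSpace ℝ (Fin p₁)) :
    IsGaussianVector (S.obs Z₁ δ) (S.H₁ *ᵥ β.ofLp + S.offset) S.V (P β) := by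
  rw [← H_mulVec]
  exact (h.isGaussianVector_sumElim_Z₂_obs β (Empty.elim : Empty → S.Q)).comp Sum.inr

theorem isGaussianVector_sumElim_single_Z₂_obs (h : S.IsModel Z₁ δ P)
    (β : EuclideanSpace ℝ (Fin p₁)) (x : S.Q) :
    IsGaussianVector (fun ω => Sum.elim (fun _ : Unit => S.Z₂ Z₁ δ x ω) (S.obs Z₁ δ ω))
      (Sum.elim (fun _ => S.h x ⬝ᵥ Sum.elim β.ofLp S.β₂) (S.H *ᵥ Sum.elim β.ofLp S.β₂))
      (fromBlocks (of fun _ _ => S.ρ ^ 2 * S.σ₁ ^ 2 + S.σ₂ ^ 2) (replicateRow Unit (S.t x))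
        (replicateCol Unit (S.t x)) S.V) (P β) := by
  have hx := h.isGaussianVector_sumElim_Z₂_obs β fun _ : Unit => x
  simp only [sub_self, S.r₁_zero, S.r₂_zero, mul_one] at hx
  exact hx

lemma krigingVar_nonneg (h : S.IsModel Z₁ δ P) (hV : IsUnit S.V.det) (x : S.Q) :
    0 ≤ S.krigingVar x :=
  (h.isGaussianVector_sumElim_single_Z₂_obs 0 x).krigingVar_nonneg hV

theorem isCondLaw_Z₂ (h : S.IsModel Z₁ δ P) (hV : IsUnit S.V.det) (x : S.Q)
    (β : EuclideanSpace ℝ (Fin p₁)) :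
    IsCondLaw (P β) (S.Z₂ Z₁ δ x) (S.obs Z₁ δ) fun z =>
      gaussianReal (S.krigingMean x β.ofLp z) (S.krigingVar x).toNNReal :=
  (h.isGaussianVector_sumElim_single_Z₂_obs β x).isCondLaw_kriging (h.measurable_Z₂ x)
    h.measurable_obs hV

lemma posDef_A (h : S.IsModel Z₁ δ P) (hR₁ : IsUnit S.R₁.det) (π : Prior p₁)
    (hF₁ : π = Prior.nonInformative → IsUnit (S.F₁ᵀ * S.R₁⁻¹ * S.F₁).det) : (S.A π).PosDef := by
  have hscore : (S.scoreMatrix * S.H₁).PosSemidef :=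
    posSemidef_mul_of_mul_eq_transpose (h.isGaussianVector_obs 0).posSemidef
      (S.scoreMatrix_mul_V hR₁)
  cases π with
  | informative b v hv =>
    rw [A_informative]
    exact (PosDef.posSemidef_add hscore (S.posDef_priorCovariance hv).inv).inv
  | nonInformative =>
    rw [A_nonInformative]
    refine (hscore.posDef_iff_isUnit.2 ?_).inv
    rw [isUnit_iff_isUnit_det, scoreMatrix_mul_H₁, Matrix.mul_smul, Matrix.smul_mul, det_smul]
    exact (IsUnit.mk0 _ (pow_ne_zero _ (inv_ne_zero (pow_ne_zero 2 S.σ₁_pos.ne')))).mul (hF₁ rfl)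

lemma predVar_nonneg (h : S.IsModel Z₁ δ P) (hV : IsUnit S.V.det) {π : Prior p₁}
    (hA : (S.A π).PosDef) (x : S.Q) : 0 ≤ S.predVar π x :=
  add_nonneg (h.krigingVar_nonneg hV x) (by simpa using hA.posSemidef.dotProduct_mulVec_nonneg _)

theorem bind_krigingLaw (h : S.IsModel Z₁ δ P) (hV : IsUnit S.V.det) {π : Prior p₁}
    (hA : (S.A π).PosDef) (x : S.Q) (z : Fin n₁ ⊕ Fin n₂ → ℝ) :
    (multivariateGaussian (WithLp.toLp 2 (S.postMean π z)) (S.A π)).bind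
        (fun β => gaussianReal (S.krigingMean x β.ofLp z) (S.krigingVar x).toNNReal) =
      gaussianReal (S.predMean π x z) (S.predVar π x).toNNReal := by
  have hk₁ : 0 ≤ S.k₁ x ⬝ᵥ S.A π *ᵥ S.k₁ x := by
    simpa using hA.posSemidef.dotProduct_mulVec_nonneg (S.k₁ x)
  simp only [predMean, predVar, krigingMean_eq]
  rw [multivariateGaussian_bind_gaussianReal _ hA.posSemidef,
    Real.toNNReal_add (h.krigingVar_nonneg hV x) hk₁, add_comm (S.krigingVar x).toNNReal]

variable [IsMarkovKernel P]

theorem isCondLaw_posterior (h : S.IsModel Z₁ δ P) (hR₁ : IsUnit S.R₁.det) {π : Prior p₁}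
    (hA : (S.A π).PosDef) :
    IsCondLaw (S.priorMeasure π ⊗ₘ P) Prod.fst (fun q => S.obs Z₁ δ q.2) fun z =>
      multivariateGaussian (WithLp.toLp 2 (S.postMean π z)) (S.A π) := by
  have hG := S.scoreMatrix_mul_V hR₁
  cases π with
  | informative b v hv =>
    have hinv := inv_mul_of_posDef_inv (S.A_informative b v hv ▸ hA)
    rw [← S.A_informative b v hv] at hinv
    simpa only [priorMeasure, postMean_informative] using isCondLaw_linearModel_of_gaussianPrior
      h.measurable_obs h.isGaussianVector_obs hG b (S.posDef_priorCovariance hv) hinv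
  | nonInformative =>
    have hinv := inv_mul_of_posDef_inv (S.A_nonInformative ▸ hA)
    rw [← S.A_nonInformative, ← Matrix.mul_assoc] at hinv
    simpa only [priorMeasure, postMean_nonInformative] using isCondLaw_linearModel_of_flatPrior
      h.measurable_obs h.isGaussianVector_obs hinv (by rw [Matrix.mul_assoc, hG])

theorem isCondLaw_Z₂_of_prior (h : S.IsModel Z₁ δ P) (hV : IsUnit S.V.det) (π : Prior p₁)
    (x : S.Q) :
    IsCondLaw (S.priorMeasure π ⊗ₘ P) (fun q => S.Z₂ Z₁ δ x q.2)
      (fun q => (S.obs Z₁ δ q.2, q.1)) fun p =>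
        gaussianReal (S.krigingMean x p.2.ofLp p.1) (S.krigingVar x).toNNReal := by
  have hm := S.measurable_krigingMean x
  have := isMarkovKernel_translationKernel (τ := gaussianReal 0 (S.krigingVar x).toNNReal) hm
  have hK (p : (Fin n₁ ⊕ Fin n₂ → ℝ) × EuclideanSpace ℝ (Fin p₁)) :
      translationKernel (gaussianReal 0 (S.krigingVar x).toNNReal)
        (fun p : (Fin n₁ ⊕ Fin n₂ → ℝ) × EuclideanSpace ℝ (Fin p₁) =>
          S.krigingMean x p.2.ofLp p.1) p =
        gaussianReal (S.krigingMean x p.2.ofLp p.1) (S.krigingVar x).toNNReal := by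
    rw [translationKernel_apply hm, gaussianReal_map_const_add, zero_add]
  simp only [← hK]
  refine IsCondLaw.compProd (h.measurable_Z₂ x) h.measurable_obs _ fun β => ?_
  simp only [hK]
  exact h.isCondLaw_Z₂ hV x β

theorem isCondLaw_pred (h : S.IsModel Z₁ δ P) (hR₁ : IsUnit S.R₁.det) (hV : IsUnit S.V.det)
    {π : Prior p₁} (hA : (S.A π).PosDef) (x : S.Q) :
    IsCondLaw (S.priorMeasure π ⊗ₘ P) (fun q => S.Z₂ Z₁ δ x q.2) (fun q => S.obs Z₁ δ q.2)
      fun z => gaussianReal (S.predMean π x z) (S.predVar π x).toNNReal := by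
  have hmZ₂ : Measurable fun q : EuclideanSpace ℝ (Fin p₁) × Ω => S.Z₂ Z₁ δ x q.2 :=
    (h.measurable_Z₂ x).comp measurable_snd
  simpa only [h.bind_krigingLaw hV hA] using (h.isCondLaw_posterior hR₁ hA).bind
    (h.isCondLaw_Z₂_of_prior hV π x) hmZ₂ measurable_fst (h.measurable_obs.comp measurable_snd)

end IsModel

end Setup

end CoKriging

theorem mainTheorem6 {d n₁ n₂ p₁ p₂ : ℕ} (S : CoKriging.Setup d n₁ n₂ p₁ p₂)
    {Ω : Type*} [MeasurableSpace Ω] (Z₁ δ : S.Q → Ω → ℝ)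
    (P : Kernel (EuclideanSpace ℝ (Fin p₁)) Ω) [IsMarkovKernel P]
    (hmodel : S.IsModel Z₁ δ P)
    (hR₁ : IsUnit S.R₁.det) (hR₂ : IsUnit S.R₂.det)
    (π : CoKriging.Prior p₁)
    (hF₁ : π = CoKriging.Prior.nonInformative → IsUnit (S.F₁ᵀ * S.R₁⁻¹ * S.F₁).det)
    (x : S.Q) :
    -- the parameters of the Gaussian laws below are admissible
    IsUnit S.V.det ∧ (S.A π).PosDef ∧ 0 ≤ S.krigingVar x ∧ 0 ≤ S.predVar π x ∧
    -- posterior law of `β₁` given the data, in the joint model of `(β₁, ω)`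
    CoKriging.IsCondLaw ((S.priorMeasure π) ⊗ₘ P)
      (fun q => q.1) (fun q => S.obs Z₁ δ q.2)
      (fun z => multivariateGaussian (WithLp.toLp 2 (S.postMean π z)) (S.A π)) ∧
    -- law of `Z₂(x)` given the data and `β₁`
    (∀ β₁ : EuclideanSpace ℝ (Fin p₁),
      CoKriging.IsCondLaw (P β₁) (S.Z₂ Z₁ δ x) (S.obs Z₁ δ)
        (fun z => gaussianReal (S.krigingMean x β₁.ofLp z) (S.krigingVar x).toNNReal)) ∧
    -- integrating `β₁` out of the latter over its posterior
    (∀ z : Fin n₁ ⊕ Fin n₂ → ℝ,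
      (multivariateGaussian (WithLp.toLp 2 (S.postMean π z)) (S.A π)).bind
          (fun β₁ => gaussianReal (S.krigingMean x β₁.ofLp z) (S.krigingVar x).toNNReal) =
        gaussianReal (S.predMean π x z) (S.predVar π x).toNNReal) ∧
    -- predictive law: `Z₂(x)` given the data, in the joint model of `(β₁, ω)`
    CoKriging.IsCondLaw ((S.priorMeasure π) ⊗ₘ P)
      (fun q => S.Z₂ Z₁ δ x q.2) (fun q => S.obs Z₁ δ q.2)
      (fun z => gaussianReal (S.predMean π x z) (S.predVar π x).toNNReal) := by
  have hV := S.isUnit_det_V hR₁ hR₂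
  have hA := hmodel.posDef_A hR₁ π hF₁
  exact ⟨hV, hA, hmodel.krigingVar_nonneg hV x, hmodel.predVar_nonneg hV hA x,
    hmodel.isCondLaw_posterior hR₁ hA, hmodel.isCondLaw_Z₂ hV x, hmodel.bind_krigingLaw hV hA x,
    hmodel.isCondLaw_pred hR₁ hV hA x⟩
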